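/- Let $\mathbb D$ be the open unit disk and let $\mathcal F=\{F_t\}_{t\ge 0}$ be a one-parameter continuous semigroup of holomorphic self-maps of $\mathbb D$ (jointly continuous in $(t,z)$, $F_{t+s}=F_t\circ F_s$, $F_0=\mathrm{id}$) generated by a holomorphic $f:\mathbb D\to\mathbb C$, i.e. $f(z)=\lim_{t\to0^+}(F_t(z)-z)/t$. Assume $f(z_0)=0$ for some $z_0\in\mathbb D$ and that $\lambda:=-f'(z_0)$ satisfies $\operatorname{Re}\lambda>0$. Then $\mathcal F$ has a Koenigs function: a univalent holomorphic $h:\mathbb D\to\mathbb C$ with $h(z_0)=0$, $h'(z_0)=1$ and $h(F_t(z))=e^{-\lambda t}h(z)$ for all $t\ge0$, $z\in\mathbb D$. Let $h$ be the Koenigs function. Let $\mathcal A$ be a complex unital Banach algebra with $\|1\|=1$. A semicocycle over $\mathcal F$ is a family of holomorphic maps $\Gamma_t:\mathbb D\to\mathcal A$, $t\ge 0$, jointly continuous in $(t,z)$, with $\Gamma_t(F_s(z))\Gamma_s(z)=\Gamma_{t+s}(z)$ and $\Gamma_0(z)=1$. It is generated by a holomorphic $B:\mathbb D\to\mathcal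 A$ if $\frac{d}{dt}\Gamma_t(z)=B(F_t(z))\Gamma_t(z)$ for all $t\ge 0$, $z\in\mathbb D$. It is linearizable if $\Gamma_t(z)=M(F_t(z))^{-1}e^{tC}M(z)$ for some $C\in\mathcal A$ and some holomorphic $M$ on $\mathbb D$ with invertible values in $\mathcal A$. Let $B_0\in\mathcal A$, put $\operatorname{ad}_{B_0}(a)=aB_0-B_0a$, let $\sigma$ denote the spectrum, and let $k\ge1$ be an integer. (a) If $A\in\mathcal A$ is not in the range of $k\lambda-\operatorname{ad}_{B_0}$, then $B(z)=B_0+h(z)^kA$ satisfies $B(z_0)=B_0$ and generates a semicocycle over $\mathcal F$, and this semicocycle is not linearizable. (b) If $\mathcal A$ is finite-dimensional and $k\lambda\in\sigma(\operatorname{ad}_{B_0})$, then an $A$ as in (a) exists. Hence, whenever the condition $\sigma(\operatorname{ad}_{B_0})\cap\{\lambda,2\lambda,3\lambda,\dots\}=\emptyset$ fails, there is a generator $B$ with $B(z_0)=B_0$ whose semicocycle is not linearizable. (c) If $\mathcal A$ is isomorphic as an algebra to a full matrix algebra $M_n(\mathbb C)$ and $k\lambda\in\sigma(B_0)-\sigma(B_0)$,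 then an $A$ as in (a) exists. Hence, whenever the condition $(\sigma(B_0)-\sigma(B_0))\cap\{\lambda,2\lambda,3\lambda,\dots\}=\emptyset$ fails, there is a generator $B$ with $B(z_0)=B_0$ whose semicocycle is not linearizable. (d) In particular, non-linearizable $M_2(\mathbb C)$-valued semicocycles exist: over the semigroup $F_t(z)=e^{-t}z$, and with the operator norm on $M_2(\mathbb C)$, the family $\Gamma_t(z)=\begin{pmatrix}e^t& zte^t\\0&e^{2t}\end{pmatrix}$ is a semicocycle generated by $B(z)=\begin{pmatrix}1&z\\0&2\end{pmatrix}$, and it is not linearizable. -/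

import Mathlib

open Set Filter Topology
open scoped Pointwise Matrix.Norms.L2Operator

universe u

noncomputable section

/-- The open unit disk of the complex plane. -/
abbrev unitDisk : Set ℂ := Metric.ball (0 : ℂ) 1

/-- A one-parameter continuous semigroup `(F t)`, `t ≥ 0`, of holomorphic self-mappings of the
open unit disk. (Values for `t < 0` or off the disk are irrelevant.) -/
structure IsHolSemigroup (F : ℝ → ℂ → ℂ) : Prop where
  holomorphic : ∀ t, 0 ≤ t → DifferentiableOn ℂ (F t) unitDisk
  mapsTo : ∀ t, 0 ≤ t → MapsTo (F t) unitDisk unitDisk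
  continuousOn : ContinuousOn (fun p : ℝ × ℂ => F p.1 p.2) (Ici 0 ×ˢ unitDisk)
  add : ∀ t s, 0 ≤ t → 0 ≤ s → ∀ z ∈ unitDisk, F (t + s) z = F t (F s z)
  zero : ∀ z ∈ unitDisk, F 0 z = z

/-- `f` is the (holomorphic) infinitesimal generator of the semigroup `F`. -/
structure IsSemigroupGenerator (F : ℝ → ℂ → ℂ) (f : ℂ → ℂ) : Prop where
  holomorphic : DifferentiableOn ℂ f unitDisk
  tendsto : ∀ z ∈ unitDisk,
    Tendsto (fun t : ℝ => (F t z - z) / (t : ℂ)) (𝓝[>] 0) (𝓝 (f z))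

/-- `h` is the normalized Koenigs function of the semigroup `F` at the interior fixed point `z₀`:
it is univalent on the disk and linearizes `F`. -/
structure IsKoenigsFunction (F : ℝ → ℂ → ℂ) (z₀ lam : ℂ) (h : ℂ → ℂ) : Prop where
  holomorphic : DifferentiableOn ℂ h unitDisk
  injOn : InjOn h unitDisk
  map_fixed : h z₀ = 0
  deriv_fixed : deriv h z₀ = 1
  schroeder : ∀ t : ℝ, 0 ≤ t → ∀ z ∈ unitDisk,
    h (F t z) = Complex.exp (-lam * (t : ℂ)) * h z

section Semicocycles

variable {𝒜 : Type u} [NormedRing 𝒜] [NormedAlgebra ℂ 𝒜]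

/-- `(Γ t)`, `t ≥ 0`, is a (holomorphic, jointly continuous) semicocycle over the semigroup `F`. -/
structure IsSemicocycle (F : ℝ → ℂ → ℂ) (Γ : ℝ → ℂ → 𝒜) : Prop where
  holomorphic : ∀ t, 0 ≤ t → DifferentiableOn ℂ (Γ t) unitDisk
  continuousOn : ContinuousOn (fun p : ℝ × ℂ => Γ p.1 p.2) (Ici 0 ×ˢ unitDisk)
  chain : ∀ t s, 0 ≤ t → 0 ≤ s → ∀ z ∈ unitDisk, Γ t (F s z) * Γ s z = Γ (t + s) z
  zero : ∀ z ∈ unitDisk, Γ 0 z = 1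

/-- `Γ` solves the evolution problem `dΓ_t(z)/dt = B(F_t(z)) Γ_t(z)`, `Γ_0(z) = 1`, `t ≥ 0`
(with a one-sided derivative at `t = 0`); that is, `Γ` is generated by `B`. -/
def SemicocycleGeneratedBy (F : ℝ → ℂ → ℂ) (Γ : ℝ → ℂ → 𝒜) (B : ℂ → 𝒜) : Prop :=
  ∀ z ∈ unitDisk, Γ 0 z = 1 ∧ ∀ t : ℝ, 0 ≤ t →
    HasDerivWithinAt (fun s : ℝ => Γ s z) (B (F t z) * Γ t z) (Ici 0) t

/-- `Γ_t(z) = M(F_t(z))⁻¹ exp(t C) M(z)` for some `C` and some holomorphic `M` on the disk with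
invertible values. -/
def IsLinearizable (F : ℝ → ℂ → ℂ) (Γ : ℝ → ℂ → 𝒜) : Prop :=
  ∃ (M : ℂ → 𝒜) (C : 𝒜), DifferentiableOn ℂ M unitDisk ∧ (∀ z ∈ unitDisk, IsUnit (M z)) ∧
    ∀ t : ℝ, 0 ≤ t → ∀ z ∈ unitDisk,
      Γ t z = Ring.inverse (M (F t z)) * NormedSpace.exp ((t : ℂ) • C) * M z

/-- `B` is holomorphic on the disk, it generates a semicocycle over `F`, and the semicocycle
generated by `B` is not linearizable. -/
def GeneratesNonlinearizable (F : ℝ → ℂ → ℂ) (B : ℂ → 𝒜) : Prop :=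
  DifferentiableOn ℂ B unitDisk ∧
  (∃ Γ : ℝ → ℂ → 𝒜, IsSemicocycle F Γ ∧ SemicocycleGeneratedBy F Γ B) ∧
  ∀ Γ : ℝ → ℂ → 𝒜, IsSemicocycle F Γ → SemicocycleGeneratedBy F Γ B → ¬ IsLinearizable F Γ

/-- The bounded operator `a ↦ a B₀ - B₀ a`. -/
def adOp (B₀ : 𝒜) : 𝒜 →L[ℂ] 𝒜 :=
  (ContinuousLinearMap.mul ℂ 𝒜).flip B₀ - ContinuousLinearMap.mul ℂ 𝒜 B₀

theorem adOp_apply (B₀ a : 𝒜) : adOp B₀ a = a * B₀ - B₀ * a := rfl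

end Semicocycles

end

/-! Non-linearizability is a residue obstruction. If `M` conjugates the semicocycle generated by `B₀
+ h^k A` to `exp(tC)`, differentiating `M(F_t) Γ_t = exp(tC) M` at `t = 0` gives `f M' + M (B₀ + h^k
A) = C M`. Since `h' f = -λ h`, the function `λ M / h^k` is, off `z₀`, a primitive of `(h'/h^(k+1))
(M B₀ - C M - kλ M) + (h'/h) M A`. Integrating over a small circle about `z₀` leaves the residue
`M(z₀) A` against the integral `J` of `(h'/h^(k+1)) M`; conjugating by `M(z₀)`, which intertwines
`B₀` and `C`, puts `A` in the range of `kλ - ad B₀` (`mem_range_of_intertwining`).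

The semicocycle exists because in the coordinate `w = h^k` the flow is `w ↦ exp(-kλt) w`: it
suffices to solve one linear equation depending on the parameter `w`, by a Dyson series entire in
`w` (`exists_scalar_cocycle`).

The Koenigs function solves `h' f = f'(z₀) h`. The only zero of `f` is `z₀` by the Schwarz lemma, so
`h` exists globally; it is univalent because orbits converge to `z₀`, where `h` is locally
injective, and each `F_t` is injective.

In finite dimension, failure of invertibility is failure of surjectivity, which yields `A`; for
matrices, rank-one products of left and right eigenvectors carry differences of eigenvalues into the
spectrum of `ad B₀`. -/

theorem isOpen_unitDisk : IsOpen unitDisk := Metric.isOpen_ball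

/-! ### Orbits as solutions of the autonomous equation `u' = f(u)` -/

section Orbits

variable {F : ℝ → ℂ → ℂ} {f : ℂ → ℂ}

theorem IsHolSemigroup.hasDerivWithinAt_zero (hF : IsHolSemigroup F)
    (hf : IsSemigroupGenerator F f) {z : ℂ} (hz : z ∈ unitDisk) :
    HasDerivWithinAt (fun t => F t z) (f z) (Ici 0) 0 := by
  rw [hasDerivWithinAt_iff_tendsto_slope, Ici_sdiff_left]
  refine (hf.tendsto z hz).congr' ?_
  filter_upwards [self_mem_nhdsWithin] with t ht
  simp only [slope, hF.zero z hz, vsub_eq_sub, sub_zero, Complex.real_smul, Complex.ofReal_inv]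
  rw [div_eq_inv_mul]

/-- The semigroup law `F_s = F_(s-t) ∘ F_t` transports the derivative at time zero to time `t`, from
the right only. -/
theorem IsHolSemigroup.hasDerivWithinAt_right (hF : IsHolSemigroup F)
    (hf : IsSemigroupGenerator F f) {z : ℂ} (hz : z ∈ unitDisk) {t : ℝ} (ht : 0 ≤ t) :
    HasDerivWithinAt (fun t => F t z) (f (F t z)) (Ici t) t := by
  have h := hF.hasDerivWithinAt_zero hf (hF.mapsTo t ht hz)
  have h1 : HasDerivWithinAt (fun s : ℝ => s - t) 1 (Ici t) t :=
    ((hasDerivAt_id t).sub_const t).hasDerivWithinAt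
  have h2 : HasDerivWithinAt (fun s => F s (F t z)) (f (F t z)) (Ici 0) ((fun s : ℝ => s - t) t) := by
    simpa using h
  have h3 := HasDerivWithinAt.scomp (h := fun s : ℝ => s - t) t h2 h1
    (fun s hs => mem_Ici.2 (sub_nonneg.2 hs))
  rw [one_smul] at h3
  refine h3.congr_of_mem (fun s hs => ?_) self_mem_Ici
  have := hF.add (s - t) t (sub_nonneg.2 hs) ht z hz
  simpa using this

theorem IsHolSemigroup.continuousOn_orbit (hF : IsHolSemigroup F) {z : ℂ} (hz : z ∈ unitDisk) :
    ContinuousOn (fun t => F t z) (Ici 0) :=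
  hF.continuousOn.comp (f := fun t : ℝ => (t, z)) (by fun_prop) fun _ ht => ⟨ht, hz⟩

/-- A continuous curve with a continuous right derivative is the integral of that derivative, hence
differentiable from both sides. Writing `max s 0` extends the integrand continuously to negative
times. -/
theorem IsHolSemigroup.hasDerivWithinAt (hF : IsHolSemigroup F)
    (hf : IsSemigroupGenerator F f) {z : ℂ} (hz : z ∈ unitDisk) {t : ℝ} (ht : 0 ≤ t) :
    HasDerivWithinAt (fun t => F t z) (f (F t z)) (Ici 0) t := by
  have hg : Continuous fun s : ℝ => f (F (max s 0) z) :=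
    hf.holomorphic.continuousOn.comp_continuous
      ((hF.continuousOn_orbit hz).comp_continuous (by fun_prop) fun s => le_max_right s 0)
      fun s => hF.mapsTo _ (le_max_right s 0) hz
  have hG : HasDerivAt (fun t => z + ∫ s in (0 : ℝ)..t, f (F (max s 0) z)) (f (F (max t 0) z)) t :=
    (intervalIntegral.integral_hasDerivAt_right (hg.intervalIntegrable _ _)
      hg.aestronglyMeasurable.stronglyMeasurableAtFilter hg.continuousAt).const_add z
  rw [max_eq_left ht] at hG
  refine hG.hasDerivWithinAt.congr_of_mem (fun t ht => ?_) ht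
  have hint := intervalIntegral.integral_eq_sub_of_hasDeriv_right_of_le (f := fun t => F t z)
    (f' := fun s => f (F (max s 0) z)) (a := 0) (b := t) ht
    ((hF.continuousOn_orbit hz).mono Icc_subset_Ici_self)
    (fun s hs => by
      have := (hF.hasDerivWithinAt_right hf hz hs.1.le).mono Ioi_subset_Ici_self
      rwa [max_eq_left hs.1.le])
    (hg.intervalIntegrable _ _)
  rw [hint, hF.zero z hz]
  ring

theorem exists_lipschitzOnWith_closedBall (hf : DifferentiableOn ℂ f unitDisk) {r : ℝ}
    (hr : r < 1) : ∃ K, LipschitzOnWith K f (Metric.closedBall 0 r) := by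
  have hsub : Metric.closedBall (0 : ℂ) r ⊆ unitDisk := Metric.closedBall_subset_ball hr
  obtain ⟨C, hC⟩ := (isCompact_closedBall (0 : ℂ) r).exists_bound_of_continuousOn
    ((hf.deriv isOpen_unitDisk).continuousOn.mono hsub)
  refine ⟨C.toNNReal, (convex_closedBall (0 : ℂ) r).lipschitzOnWith_of_nnnorm_deriv_le
    (fun x hx => hf.differentiableAt (isOpen_unitDisk.mem_nhds (hsub hx))) fun x hx => ?_⟩
  rw [← NNReal.coe_le_coe]
  exact (hC x hx).trans (Real.le_coe_toNNReal C)

theorem IsHolSemigroup.exists_orbit_subset (hF : IsHolSemigroup F) {z : ℂ} (hz : z ∈ unitDisk)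
    {T : ℝ} (hT : 0 ≤ T) : ∃ r < 1, ∀ t ∈ Icc 0 T, F t z ∈ Metric.closedBall (0 : ℂ) r := by
  obtain ⟨s, hs, hmax⟩ := (isCompact_Icc (a := 0) (b := T)).exists_isMaxOn ⟨0, le_refl _, hT⟩
    (((hF.continuousOn_orbit hz).mono Icc_subset_Ici_self).norm)
  refine ⟨‖F s z‖, by simpa using hF.mapsTo s hs.1 hz, fun t ht => ?_⟩
  simpa using hmax ht

/-- Backward uniqueness: both orbits up to time `T` lie in one compact disk, on which `f` is
Lipschitz. -/
theorem IsHolSemigroup.injOn (hF : IsHolSemigroup F) (hf : IsSemigroupGenerator F f) {T : ℝ}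
    (hT : 0 ≤ T) : InjOn (F T) unitDisk := by
  intro z hz w hw h
  obtain ⟨r, hr, hzr⟩ := hF.exists_orbit_subset hz hT
  obtain ⟨r', hr', hwr⟩ := hF.exists_orbit_subset hw hT
  obtain ⟨K, hK⟩ := exists_lipschitzOnWith_closedBall hf.holomorphic (max_lt hr hr')
  have key : ∀ {x}, x ∈ unitDisk → ∀ t ∈ Ioc 0 T,
      HasDerivWithinAt (fun t => F t x) (f (F t x)) (Iic t) t := fun hx t ht =>
    ((hF.hasDerivWithinAt hf hx ht.1.le).hasDerivAt (Ici_mem_nhds ht.1)).hasDerivWithinAt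
  have := ODE_solution_unique_of_mem_Icc_left (v := fun _ => f) (K := K) (a := 0) (b := T)
    (s := fun _ => Metric.closedBall 0 (max r r')) (f := fun t => F t z) (g := fun t => F t w)
    (fun _ _ => hK) ((hF.continuousOn_orbit hz).mono Icc_subset_Ici_self) (key hz)
    (fun t ht => Metric.closedBall_subset_closedBall (le_max_left _ _) (hzr t ⟨ht.1.le, ht.2⟩))
    ((hF.continuousOn_orbit hw).mono Icc_subset_Ici_self) (key hw)
    (fun t ht => Metric.closedBall_subset_closedBall (le_max_right _ _) (hwr t ⟨ht.1.le, ht.2⟩)) h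
  simpa [hF.zero z hz, hF.zero w hw] using this ⟨le_refl (0 : ℝ), hT⟩

theorem IsHolSemigroup.fixed_of_generator_eq_zero (hF : IsHolSemigroup F)
    (hf : IsSemigroupGenerator F f) {z : ℂ} (hz : z ∈ unitDisk) (hfz : f z = 0) {T : ℝ}
    (hT : 0 ≤ T) : F T z = z := by
  obtain ⟨r, hr, hzr⟩ := hF.exists_orbit_subset hz hT
  obtain ⟨K, hK⟩ := exists_lipschitzOnWith_closedBall hf.holomorphic hr
  have h0 : z ∈ Metric.closedBall (0 : ℂ) r := by
    simpa [hF.zero z hz] using hzr 0 ⟨le_refl _, hT⟩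
  exact ODE_solution_unique_of_mem_Icc_right (v := fun _ => f) (K := K) (a := 0) (b := T)
    (s := fun _ => Metric.closedBall 0 r) (f := fun t => F t z) (g := fun _ => z)
    (fun _ _ => hK) ((hF.continuousOn_orbit hz).mono Icc_subset_Ici_self)
    (fun t ht => hF.hasDerivWithinAt_right hf hz ht.1)
    (fun t ht => hzr t ⟨ht.1, ht.2.le⟩) continuousOn_const
    (fun t _ => by simpa [hfz] using hasDerivWithinAt_const t (Ici t) z) (fun _ _ => h0)
    (hF.zero z hz) ⟨hT, le_refl T⟩

end Orbits

/-! ### Disk automorphisms and the Schwarz lemma at a fixed point -/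

section DiskInvolution

open ComplexConjugate

/-- The involutive automorphism of the disk that exchanges `a` and `0`. -/
noncomputable def diskInvolution (a z : ℂ) : ℂ := (a - z) / (1 - conj a * z)

theorem one_sub_conj_mul_ne_zero {a z : ℂ} (ha : a ∈ unitDisk) (hz : z ∈ unitDisk) :
    1 - conj a * z ≠ 0 := by
  intro h
  have h1 : ‖conj a * z‖ = 1 := by rw [← sub_eq_zero.1 h, norm_one]
  rw [norm_mul, RCLike.norm_conj] at h1
  have ha' : ‖a‖ < 1 := by simpa using ha
  have hz' : ‖z‖ < 1 := by simpa using hz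
  nlinarith [norm_nonneg a, norm_nonneg z]

theorem one_sub_normSq_diskInvolution {a z : ℂ} (ha : a ∈ unitDisk) (hz : z ∈ unitDisk) :
    (1 - Complex.normSq (diskInvolution a z)) * Complex.normSq (1 - conj a * z) =
      (1 - Complex.normSq a) * (1 - Complex.normSq z) := by
  have h := Complex.normSq_pos.2 (one_sub_conj_mul_ne_zero ha hz)
  rw [diskInvolution, map_div₀, sub_mul, div_mul_cancel₀ _ h.ne']
  simp only [Complex.normSq_apply, Complex.sub_re, Complex.sub_im, Complex.mul_re, Complex.mul_im,
    Complex.conj_re, Complex.conj_im, Complex.one_re, Complex.one_im]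
  ring

theorem normSq_lt_one_iff {z : ℂ} : Complex.normSq z < 1 ↔ z ∈ unitDisk := by
  rw [Complex.normSq_eq_norm_sq, mem_ball_zero_iff, sq_lt_one_iff₀ (norm_nonneg z)]

theorem diskInvolution_mem {a z : ℂ} (ha : a ∈ unitDisk) (hz : z ∈ unitDisk) :
    diskInvolution a z ∈ unitDisk := by
  have h := Complex.normSq_pos.2 (one_sub_conj_mul_ne_zero ha hz)
  have h1 := one_sub_normSq_diskInvolution ha hz
  have h2 : 0 < (1 - Complex.normSq a) * (1 - Complex.normSq z) :=
    mul_pos (sub_pos.2 (normSq_lt_one_iff.2 ha)) (sub_pos.2 (normSq_lt_one_iff.2 hz))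
  rw [← h1] at h2
  exact normSq_lt_one_iff.1 (sub_pos.1 (pos_of_mul_pos_left h2 h.le))

theorem diskInvolution_diskInvolution {a z : ℂ} (ha : a ∈ unitDisk) (hz : z ∈ unitDisk) :
    diskInvolution a (diskInvolution a z) = z := by
  have h := one_sub_conj_mul_ne_zero ha hz
  have h' := one_sub_conj_mul_ne_zero ha (diskInvolution_mem ha hz)
  have h2 : diskInvolution a z * (1 - conj a * z) = a - z := div_mul_cancel₀ _ h
  rw [diskInvolution, div_eq_iff h']
  linear_combination (-1 : ℂ) * h2

theorem diskInvolution_self (a : ℂ) : diskInvolution a a = 0 := by simp [diskInvolution]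

theorem diskInvolution_zero (a : ℂ) : diskInvolution a 0 = a := by simp [diskInvolution]

theorem differentiableOn_diskInvolution {a : ℂ} (ha : a ∈ unitDisk) :
    DifferentiableOn ℂ (diskInvolution a) unitDisk := fun _ hz =>
  (((differentiableAt_const a).sub differentiableAt_id).div
    ((differentiableAt_const 1).sub ((differentiableAt_const _).mul differentiableAt_id))
    (one_sub_conj_mul_ne_zero ha hz)).differentiableWithinAt

variable {G : ℂ → ℂ} {a : ℂ}

theorem differentiableOn_conj_diskInvolution (ha : a ∈ unitDisk)
    (hG : DifferentiableOn ℂ G unitDisk) (hmaps : MapsTo G unitDisk unitDisk) :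
    DifferentiableOn ℂ (fun z => diskInvolution a (G (diskInvolution a z))) unitDisk :=
  (differentiableOn_diskInvolution ha).comp
    (hG.comp (differentiableOn_diskInvolution ha) fun _ hz => diskInvolution_mem ha hz)
    fun _ hz => hmaps (diskInvolution_mem ha hz)

/-- Schwarz–Pick lemma at a fixed point. -/
theorem norm_diskInvolution_le_of_fixed (ha : a ∈ unitDisk) (hG : DifferentiableOn ℂ G unitDisk)
    (hmaps : MapsTo G unitDisk unitDisk) (hfix : G a = a) {z : ℂ} (hz : z ∈ unitDisk) :
    ‖diskInvolution a (G z)‖ ≤ ‖diskInvolution a z‖ := by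
  have := Complex.norm_le_norm_of_mapsTo_ball (differentiableOn_conj_diskInvolution ha hG hmaps)
    (fun w hw => Metric.ball_subset_closedBall
      (diskInvolution_mem ha (hmaps (diskInvolution_mem ha hw))))
    (by simp [diskInvolution_zero, hfix, diskInvolution_self])
    (mem_ball_zero_iff.1 (diskInvolution_mem ha hz))
  simpa [diskInvolution_diskInvolution ha hz] using this

/-- A holomorphic self-map of the disk with two distinct fixed points is the identity. -/
theorem eqOn_id_of_two_fixed (ha : a ∈ unitDisk) (hG : DifferentiableOn ℂ G unitDisk)
    (hmaps : MapsTo G unitDisk unitDisk) (hfix : G a = a) {b : ℂ} (hb : b ∈ unitDisk)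
    (hab : b ≠ a) (hfixb : G b = b) : EqOn G id unitDisk := by
  set H : ℂ → ℂ := fun z => diskInvolution a (G (diskInvolution a z)) with hH
  have hH0 : H 0 = 0 := by simp [hH, diskInvolution_zero, hfix, diskInvolution_self]
  have hβ := diskInvolution_mem ha hb
  have hHβ : H (diskInvolution a b) = diskInvolution a b := by
    simp [hH, diskInvolution_diskInvolution ha hb, hfixb]
  have hβ0 : diskInvolution a b ≠ 0 := by
    intro h0
    apply hab
    rw [← diskInvolution_diskInvolution ha hb, h0, diskInvolution_zero]
  have hslope : dslope H 0 (diskInvolution a b) = 1 := by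
    rw [dslope_of_ne _ hβ0, slope_def_field, hHβ, hH0, sub_zero, div_self hβ0]
  -- Equality case of the Schwarz lemma: the slope between the fixed points `0` and `diskInvolution
  -- a b` is `1`, so `H` is affine, hence the identity.
  have haff := Complex.affine_of_mapsTo_ball_of_norm_dslope_eq_div
    (differentiableOn_conj_diskInvolution ha hG hmaps) (R₂ := 1)
    (fun w hw => by
      rw [show diskInvolution a (G (diskInvolution a 0)) = 0 from hH0]
      exact Metric.ball_subset_closedBall
        (diskInvolution_mem ha (hmaps (diskInvolution_mem ha hw)))) hβ
    (by rw [← hH, hslope]; simp)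
  intro z hz
  have h1 := haff (diskInvolution_mem ha hz)
  rw [← hH, hslope] at h1
  simp only [hH, diskInvolution_diskInvolution ha hz, diskInvolution_zero, hfix, diskInvolution_self,
    sub_zero, smul_eq_mul, mul_one, zero_add] at h1
  have h2 := congrArg (diskInvolution a) h1
  rwa [diskInvolution_diskInvolution ha (hmaps hz), diskInvolution_diskInvolution ha hz] at h2

/-- Sublevel sets of `‖diskInvolution a ·‖` stay away from the unit circle. -/
theorem exists_mem_closedBall_of_norm_diskInvolution_le (ha : a ∈ unitDisk) {ρ : ℝ} (hρ : ρ < 1) :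
    ∃ r < 1, ∀ z ∈ unitDisk, ‖diskInvolution a z‖ ≤ ρ → z ∈ Metric.closedBall (0 : ℂ) r := by
  have hcont : ContinuousOn (diskInvolution a) (Metric.closedBall 0 ρ) :=
    (differentiableOn_diskInvolution ha).continuousOn.mono (Metric.closedBall_subset_ball hρ)
  rcases lt_or_ge ρ 0 with hneg | hpos
  · exact ⟨0, one_pos, fun z _ h => absurd (h.trans_lt hneg) (norm_nonneg _).not_gt⟩
  obtain ⟨s, hs, hmax⟩ := (isCompact_closedBall (0 : ℂ) ρ).exists_isMaxOn
    (Metric.nonempty_closedBall.2 hpos) hcont.norm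
  refine ⟨‖diskInvolution a s‖, mem_ball_zero_iff.1
    (diskInvolution_mem ha (Metric.closedBall_subset_ball hρ hs)), fun z hz h => ?_⟩
  have := hmax (mem_closedBall_zero_iff.2 h)
  simpa [diskInvolution_diskInvolution ha hz] using this

end DiskInvolution

/-! ### Existence and univalence of the Koenigs function -/

section Koenigs

variable {F : ℝ → ℂ → ℂ} {f h : ℂ → ℂ} {z₀ lam : ℂ}

/-- A second zero of `f` would be a second fixed point of every `F_t`, forcing `F_t = id` and `f =
0` on the disk. -/
theorem IsHolSemigroup.generator_ne_zero (hF : IsHolSemigroup F) (hf : IsSemigroupGenerator F f)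
    (hz₀ : z₀ ∈ unitDisk) (hfz₀ : f z₀ = 0) (hd : deriv f z₀ ≠ 0) {z : ℂ} (hz : z ∈ unitDisk)
    (hne : z ≠ z₀) : f z ≠ 0 := by
  intro hfz
  have hid : ∀ t, 0 ≤ t → EqOn (F t) id unitDisk := fun t ht =>
    eqOn_id_of_two_fixed hz₀ (hF.holomorphic t ht) (hF.mapsTo t ht)
      (hF.fixed_of_generator_eq_zero hf hz₀ hfz₀ ht) hz hne
      (hF.fixed_of_generator_eq_zero hf hz hfz ht)
  have hzero : ∀ w ∈ unitDisk, f w = 0 := by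
    intro w hw
    refine tendsto_nhds_unique (hf.tendsto w hw) (tendsto_const_nhds.congr' ?_)
    filter_upwards [self_mem_nhdsWithin] with t ht
    rw [hid t (le_of_lt ht) hw, id, sub_self, zero_div]
  apply hd
  have : f =ᶠ[𝓝 z₀] fun _ => 0 := by
    filter_upwards [isOpen_unitDisk.mem_nhds hz₀] with w hw using hzero w hw
  rw [this.deriv_eq, deriv_const]

/-- The linear equation `h' f = -λ h` has a normalized solution that vanishes only at `z₀`. -/
theorem exists_linearizing_function (hf : DifferentiableOn ℂ f unitDisk) (hz₀ : z₀ ∈ unitDisk)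
    (hfz₀ : f z₀ = 0) (hd : deriv f z₀ ≠ 0) (hne : ∀ z ∈ unitDisk, z ≠ z₀ → f z ≠ 0) :
    ∃ h : ℂ → ℂ, DifferentiableOn ℂ h unitDisk ∧ h z₀ = 0 ∧ deriv h z₀ = 1 ∧
      (∀ z ∈ unitDisk, h z = 0 → z = z₀) ∧
      ∀ z ∈ unitDisk, deriv h z * f z = deriv f z₀ * h z := by
  have hnhds := isOpen_unitDisk.mem_nhds hz₀
  set g := dslope f z₀ with hg_def
  have hg : DifferentiableOn ℂ g unitDisk := (Complex.differentiableOn_dslope hnhds).2 hf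
  have hq : DifferentiableOn ℂ (dslope g z₀) unitDisk :=
    (Complex.differentiableOn_dslope hnhds).2 hg
  have hfg : ∀ z, f z = (z - z₀) * g z := fun z => by
    simpa [hfz₀] using (sub_smul_dslope f z₀ z).symm
  have hgq : ∀ z, g z - g z₀ = (z - z₀) * dslope g z₀ z := fun z => by
    simpa using (sub_smul_dslope g z₀ z).symm
  have hgz₀ : g z₀ = deriv f z₀ := dslope_same f z₀
  have hg0 : ∀ z ∈ unitDisk, g z ≠ 0 := by
    intro z hz h0
    rcases eq_or_ne z z₀ with rfl | h1
    · exact hd (hgz₀ ▸ h0)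
    · exact hne z hz h1 (by rw [hfg, h0, mul_zero])
  -- With `f = (z - z₀) g` and the ansatz `h = (z - z₀) exp P`, the equation becomes `P' = (g(z₀) -
  -- g) / ((z - z₀) g)`; `dslope` removes the singularity at `z₀`.
  have hp : DifferentiableOn ℂ (fun z => -dslope g z₀ z / g z) unitDisk := hq.neg.div hg hg0
  obtain ⟨P, hP0, hP⟩ := hp.isExactOn_ball.with_val_at z₀ 0
  have hderiv : ∀ z ∈ unitDisk, HasDerivAt (fun z => (z - z₀) * Complex.exp (P z))
      (Complex.exp (P z) + (z - z₀) * (Complex.exp (P z) * (-dslope g z₀ z / g z))) z := by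
    intro z hz
    have := ((hasDerivAt_id z).sub_const z₀).mul (hP z hz).cexp
    exact this.congr_deriv (by simp)
  refine ⟨fun z => (z - z₀) * Complex.exp (P z),
    fun z hz => (hderiv z hz).differentiableAt.differentiableWithinAt, by simp, ?_, ?_, ?_⟩
  · rw [(hderiv z₀ hz₀).deriv]
    simp [hP0]
  · intro z _ h0
    rcases mul_eq_zero.1 h0 with h1 | h1
    · exact sub_eq_zero.1 h1
    · exact absurd h1 (Complex.exp_ne_zero _)
  · intro z hz
    rw [(hderiv z hz).deriv, hfg z, ← hgz₀]
    have h1 := hg0 z hz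
    field_simp
    linear_combination (z - z₀) * hgq z

/-- The infinitesimal equation says that `exp(λt) h(F_t z)` has zero derivative in `t`. -/
theorem IsHolSemigroup.schroeder (hF : IsHolSemigroup F) (hf : IsSemigroupGenerator F f)
    (hh : DifferentiableOn ℂ h unitDisk)
    (heq : ∀ z ∈ unitDisk, deriv h z * f z = -lam * h z) {z : ℂ} (hz : z ∈ unitDisk) {t : ℝ}
    (ht : 0 ≤ t) : h (F t z) = Complex.exp (-lam * t) * h z := by
  have hd : ∀ s : ℝ, 0 ≤ s →
      HasDerivWithinAt (fun s : ℝ => Complex.exp (lam * s) * h (F s z)) 0 (Ici 0) s := by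
    intro s hs
    have hmem := hF.mapsTo s hs hz
    have h1 : HasDerivWithinAt (fun s : ℝ => h (F s z)) (deriv h (F s z) * f (F s z)) (Ici 0) s :=
      (hh.hasDerivAt (isOpen_unitDisk.mem_nhds hmem)).comp_hasDerivWithinAt s
        (hF.hasDerivWithinAt hf hz hs)
    have h2 : HasDerivWithinAt (fun s : ℝ => Complex.exp (lam * s))
        (Complex.exp (lam * s) * (lam * 1)) (Ici 0) s :=
      (((hasDerivAt_id s).ofReal_comp.const_mul lam).cexp).hasDerivWithinAt
    refine (h2.mul h1).congr_deriv ?_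
    rw [heq _ hmem]
    ring
  have hconst := constant_of_has_deriv_right_zero (a := 0) (b := t)
    (fun s hs => (hd s hs.1).continuousWithinAt.mono Icc_subset_Ici_self)
    (fun s hs => (hd s hs.1).mono (Ici_subset_Ici.2 hs.1)) t ⟨ht, le_refl t⟩
  simp only [Complex.ofReal_zero, mul_zero, Complex.exp_zero, one_mul, hF.zero z hz] at hconst
  rw [← hconst, ← mul_assoc, ← Complex.exp_add]
  simp

theorem tendsto_exp_neg_mul_atTop (hlam : 0 < lam.re) :
    Tendsto (fun t : ℝ => Complex.exp (-lam * t)) atTop (𝓝 0) := by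
  rw [tendsto_zero_iff_norm_tendsto_zero]
  simp only [Complex.norm_exp]
  refine Real.tendsto_exp_atBot.comp ?_
  have : (fun t : ℝ => (-lam * (t : ℂ)).re) = fun t : ℝ => -lam.re * t := by
    ext t
    simp
  rw [this]
  exact tendsto_id.const_mul_atTop_of_neg (neg_neg_of_pos hlam)

/-- Schwarz–Pick confines the orbit to a compact subset of the disk, and `h(F_t z) → 0` makes every
cluster point a zero of `h`. -/
theorem IsHolSemigroup.tendsto_fixed (hF : IsHolSemigroup F) (hz₀ : z₀ ∈ unitDisk)
    (hfix : ∀ t, 0 ≤ t → F t z₀ = z₀) (hlam : 0 < lam.re) (hh : DifferentiableOn ℂ h unitDisk)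
    (hzero : ∀ z ∈ unitDisk, h z = 0 → z = z₀)
    (hs : ∀ t : ℝ, 0 ≤ t → ∀ z ∈ unitDisk, h (F t z) = Complex.exp (-lam * t) * h z)
    {z : ℂ} (hz : z ∈ unitDisk) : Tendsto (fun t => F t z) atTop (𝓝 z₀) := by
  obtain ⟨r, hr, hsub⟩ := exists_mem_closedBall_of_norm_diskInvolution_le hz₀
    (mem_ball_zero_iff.1 (diskInvolution_mem hz₀ hz))
  have hlim : Tendsto (fun t => h (F t z)) atTop (𝓝 0) := by
    have h1 := (tendsto_exp_neg_mul_atTop hlam).mul_const (h z)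
    rw [zero_mul] at h1
    refine h1.congr' ?_
    filter_upwards [eventually_ge_atTop 0] with t ht using (hs t ht z hz).symm
  refine (isCompact_closedBall (0 : ℂ) r).tendsto_nhds_of_unique_mapClusterPt ?_ ?_
  · filter_upwards [eventually_ge_atTop 0] with t ht
    exact hsub _ (hF.mapsTo t ht hz) (norm_diskInvolution_le_of_fixed hz₀ (hF.holomorphic t ht)
      (hF.mapsTo t ht) (hfix t ht) hz)
  · intro y hy hcl
    have hyD : y ∈ unitDisk := Metric.closedBall_subset_ball hr hy
    refine hzero y hyD ?_
    have hcont : ContinuousAt h y :=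
      (hh.differentiableAt (isOpen_unitDisk.mem_nhds hyD)).continuousAt
    have h2 : MapClusterPt (h y) atTop (fun t => h (F t z)) := hcl.continuousAt_comp hcont
    exact eq_of_nhds_neBot (ClusterPt.mono h2 hlim)

theorem IsHolSemigroup.exists_isKoenigsFunction (hF : IsHolSemigroup F)
    (hf : IsSemigroupGenerator F f) (hz₀ : z₀ ∈ unitDisk) (hfz₀ : f z₀ = 0)
    (hlam : lam = -deriv f z₀) (hre : 0 < lam.re) : ∃ h, IsKoenigsFunction F z₀ lam h := by
  have hd : deriv f z₀ ≠ 0 := by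
    rintro h0
    simp [hlam, h0] at hre
  obtain ⟨h, hh, h0, h1, hzero, heq⟩ := exists_linearizing_function hf.holomorphic hz₀ hfz₀ hd
    fun z hz hne => hF.generator_ne_zero hf hz₀ hfz₀ hd hz hne
  have hs : ∀ t : ℝ, 0 ≤ t → ∀ z ∈ unitDisk, h (F t z) = Complex.exp (-lam * t) * h z :=
    fun t ht z hz => hF.schroeder hf hh (fun w hw => by rw [heq w hw, hlam, neg_neg]) hz ht
  refine ⟨h, hh, ?_, h0, h1, hs⟩
  intro z hz w hw hzw
  have hlim : ∀ x ∈ unitDisk, Tendsto (fun t => F t x) atTop (𝓝 z₀) := fun x hx =>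
    hF.tendsto_fixed hz₀ (fun t ht => hF.fixed_of_generator_eq_zero hf hz₀ hfz₀ ht) hre hh hzero
      hs hx
  -- Near `z₀` the function `h` has a left inverse. For large `t` both orbits are there, so equal
  -- values of `h` give `F_t z = F_t w`, and `F_t` is injective.
  have hstrict : HasStrictDerivAt h 1 z₀ := by
    have := (hh.analyticAt (isOpen_unitDisk.mem_nhds hz₀)).hasStrictDerivAt
    rwa [h1] at this
  have hinv := (hstrict.hasStrictFDerivAt_equiv one_ne_zero).eventually_left_inverse
  obtain ⟨t, ⟨h2, h3⟩, ht⟩ := (((hlim z hz).eventually hinv).and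
    ((hlim w hw).eventually hinv) |>.and (eventually_ge_atTop (0 : ℝ))).exists
  refine hF.injOn hf ht hz hw ?_
  rw [← h2, ← h3, hs t ht z hz, hs t ht w hw, hzw]

end Koenigs

theorem ContinuousLinearMap.circleIntegral_comp_comm {E E' : Type*} [NormedAddCommGroup E]
    [NormedSpace ℂ E] [NormedAddCommGroup E'] [NormedSpace ℂ E'] [CompleteSpace E]
    [CompleteSpace E'] (L : E →L[ℂ] E') {φ : ℂ → E} {c : ℂ} {R : ℝ}
    (hφ : CircleIntegrable φ c R) : (∮ z in C(c, R), L (φ z)) = L (∮ z in C(c, R), φ z) := by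
  simp only [circleIntegral]
  rw [← L.intervalIntegral_comp_comm hφ.out]
  simp

/-! ### The residue obstruction to linearization -/

section Nonlinearizable

variable {𝒜 : Type u} [NormedRing 𝒜] [NormedAlgebra ℂ 𝒜] [CompleteSpace 𝒜]
  {F : ℝ → ℂ → ℂ} {f h : ℂ → ℂ} {z₀ lam : ℂ}

/-- A holomorphic intertwiner of `C` and `B₀ + h ^ k A` forces `A` into the range of
`k λ - ad B₀`: integrate against `h' / h ^ (k + 1)` around `z₀`. -/
theorem mem_range_of_intertwining (hz₀ : z₀ ∈ unitDisk) (hh : DifferentiableOn ℂ h unitDisk)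
    (hinj : InjOn h unitDisk) (h0 : h z₀ = 0) (h1 : deriv h z₀ = 1)
    (hode : ∀ z ∈ unitDisk, deriv h z * f z = -lam * h z) {M : ℂ → 𝒜} {B₀ A C : 𝒜} {k : ℕ}
    (hk : 1 ≤ k) (hM : DifferentiableOn ℂ M unitDisk) (hunit : IsUnit (M z₀))
    (heq : ∀ z ∈ unitDisk, f z • deriv M z + M z * (B₀ + h z ^ k • A) = C * M z) :
    A ∈ range (fun a : 𝒜 => ((k : ℂ) * lam) • a - adOp B₀ a) := by
  have hnhds := isOpen_unitDisk.mem_nhds hz₀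
  have hfz₀ : f z₀ = 0 := by simpa [h0, h1] using hode z₀ hz₀
  obtain ⟨r, hr, hsub⟩ := Metric.nhds_basis_closedBall.mem_iff.1 hnhds
  have hq : DifferentiableOn ℂ (dslope h z₀) unitDisk :=
    (Complex.differentiableOn_dslope hnhds).2 hh
  have hhq : ∀ z, h z = (z - z₀) * dslope h z₀ z := fun z => by
    simpa [h0] using (sub_smul_dslope h z₀ z).symm
  have hne : ∀ z ∈ unitDisk, z ≠ z₀ → h z ≠ 0 := fun z hz hzz hz0 =>
    hzz (hinj hz hz₀ (hz0.trans h0.symm))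
  have hq0 : ∀ z ∈ unitDisk, dslope h z₀ z ≠ 0 := by
    intro z hz hz0
    rcases eq_or_ne z z₀ with rfl | hzz
    · rw [dslope_same, h1] at hz0
      exact one_ne_zero hz0
    · exact hne z hz hzz (by rw [hhq, hz0, mul_zero])
  have hdh := hh.deriv isOpen_unitDisk
  have hsph : ∀ z ∈ Metric.sphere z₀ r, z ∈ unitDisk ∧ h z ≠ 0 := fun z hz =>
    ⟨hsub (Metric.sphere_subset_closedBall hz), hne z (hsub (Metric.sphere_subset_closedBall hz))
      (Metric.ne_of_mem_sphere hz hr.ne')⟩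
  have hsubS : Metric.sphere z₀ r ⊆ unitDisk := fun z hz => (hsph z hz).1
  set φ : ℂ → 𝒜 := fun z => (deriv h z / h z ^ (k + 1)) • M z with hφ
  set ψ : ℂ → 𝒜 := fun z => (deriv h z / h z) • M z with hψ
  have hφc : ContinuousOn φ (Metric.sphere z₀ r) :=
    ((hdh.continuousOn.mono hsubS).div ((hh.continuousOn.mono hsubS).pow _)
      fun z hz => pow_ne_zero _ (hsph z hz).2).smul (hM.continuousOn.mono hsubS)
  have hψc : ContinuousOn ψ (Metric.sphere z₀ r) :=
    ((hdh.continuousOn.mono hsubS).div (hh.continuousOn.mono hsubS)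
      fun z hz => (hsph z hz).2).smul (hM.continuousOn.mono hsubS)
  -- Cauchy's formula, with `h'/h = (z - z₀)⁻¹ (h' / dslope h z₀)` and the last factor equal to `1`
  -- at `z₀`.
  have hψint : (∮ z in C(z₀, r), ψ z) = (2 * Real.pi * Complex.I : ℂ) • M z₀ := by
    have hd : DifferentiableOn ℂ (fun z => (deriv h z / dslope h z₀ z) • M z)
        (Metric.closedBall z₀ r) := ((hdh.div hq hq0).smul hM).mono hsub
    have := hd.circleIntegral_sub_inv_smul (Metric.mem_ball_self hr)
    simp only [dslope_same, h1, div_one, one_smul] at this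
    rw [← this]
    refine circleIntegral.integral_congr hr.le fun z hz => ?_
    simp only [hψ, smul_smul]
    congr 1
    rw [hhq z]
    field_simp
  let L : 𝒜 →L[ℂ] 𝒜 := (ContinuousLinearMap.mul ℂ 𝒜).flip B₀ - ContinuousLinearMap.mul ℂ 𝒜 C -
    ((k : ℂ) * lam) • ContinuousLinearMap.id ℂ 𝒜
  let R : 𝒜 →L[ℂ] 𝒜 := (ContinuousLinearMap.mul ℂ 𝒜).flip A
  have hL : ∀ x, L x = x * B₀ - C * x - ((k : ℂ) * lam) • x := fun x => rfl
  have hR : ∀ x, R x = x * A := fun x => rfl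
  have hprim : ∀ z ∈ Metric.sphere z₀ r, HasDerivWithinAt (fun z => (lam / h z ^ k) • M z)
      (L (φ z) + R (ψ z)) (Metric.sphere z₀ r) z := by
    intro z hz
    obtain ⟨hzD, hz0⟩ := hsph z hz
    have hz' := isOpen_unitDisk.mem_nhds hzD
    have d1 := (hh.hasDerivAt hz').pow k
    have d2 := (((hasDerivAt_const z lam).div d1 (pow_ne_zero k hz0)).smul (hM.hasDerivAt hz'))
    refine (d2.congr_deriv ?_).hasDerivWithinAt
    have e := heq z hzD
    have e2 := hode z hzD
    rw [hL, hR]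
    simp only [hφ, hψ, Pi.pow_apply, Pi.div_apply]
    have e3 : C * M z = f z • deriv M z + M z * B₀ + h z ^ k • (M z * A) := by
      rw [← e, mul_add, mul_smul_comm, add_assoc]
    simp only [smul_mul_assoc, mul_smul_comm, e3, smul_add, smul_smul]
    have c1 : deriv h z / h z ^ (k + 1) * f z = -(lam / h z ^ k) := by
      rw [div_mul_eq_mul_div, e2]
      field_simp
      ring
    have c2 : deriv h z / h z ^ (k + 1) * h z ^ k = deriv h z / h z := by
      field_simp
      ring
    -- Removes the truncated exponent `k - 1` produced by differentiating `h ^ k`.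
    obtain ⟨j, rfl⟩ : ∃ j, k = j + 1 := ⟨k - 1, by omega⟩
    have c3 : (0 * h z ^ (j + 1) - lam * (((j + 1 : ℕ) : ℂ) * h z ^ (j + 1 - 1) * deriv h z)) /
        (h z ^ (j + 1)) ^ 2 =
        -(((j + 1 : ℕ) : ℂ) * lam * (deriv h z / h z ^ (j + 1 + 1))) := by
      rw [Nat.add_sub_cancel]
      field_simp
      ring
    rw [c1, c2, c3]
    module
  have hint : L (∮ z in C(z₀, r), φ z) + R (∮ z in C(z₀, r), ψ z) = 0 := by
    rw [← L.circleIntegral_comp_comm (hφc.circleIntegrable hr.le),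
      ← R.circleIntegral_comp_comm (hψc.circleIntegrable hr.le)]
    refine (circleIntegral.integral_add
      ((L.continuous.comp_continuousOn hφc).circleIntegrable hr.le)
      ((R.continuous.comp_continuousOn hψc).circleIntegrable hr.le)).symm.trans ?_
    exact circleIntegral.integral_eq_zero_of_hasDerivWithinAt hr.le hprim
  rw [hψint, hL, hR] at hint
  obtain ⟨V, hV⟩ := hunit
  have hVM : (↑V⁻¹ : 𝒜) * M z₀ = 1 := by rw [← hV, Units.inv_mul]
  have hMV : M z₀ * (↑V⁻¹ : 𝒜) = 1 := by rw [← hV, Units.mul_inv]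
  -- The intertwining equation at `z₀`, where `f` and `h ^ k` vanish.
  have hC : M z₀ * B₀ = C * M z₀ := by
    have := heq z₀ hz₀
    simpa [hfz₀, h0, zero_pow (by omega : k ≠ 0)] using this
  have hVC : (↑V⁻¹ : 𝒜) * C = B₀ * ↑V⁻¹ := by
    calc (↑V⁻¹ : 𝒜) * C = ↑V⁻¹ * (C * M z₀) * ↑V⁻¹ := by
          rw [mul_assoc, mul_assoc C, hMV, mul_one]
      _ = B₀ * ↑V⁻¹ := by rw [← hC, ← mul_assoc, hVM, one_mul]
  set J := ∮ z in C(z₀, r), φ z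
  have hpi : (2 * Real.pi * Complex.I : ℂ) ≠ 0 := Complex.two_pi_I_ne_zero
  set τ : ℂ := 2 * Real.pi * Complex.I
  -- The vanishing integral solves for `τ • (M z₀ * A)` in terms of `J`; left multiplication by
  -- `V⁻¹` turns `C` into `B₀`.
  refine ⟨τ⁻¹ • (↑V⁻¹ * J), ?_⟩
  have hJ : ((k : ℂ) * lam) • J - J * B₀ + C * J = τ • (M z₀ * A) := by
    rw [smul_mul_assoc] at hint
    rw [← sub_eq_zero, ← neg_eq_zero, ← hint]
    abel
  have hJ' := congrArg (fun x => τ⁻¹ • ((↑V⁻¹ : 𝒜) * x)) hJ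
  simp only [mul_smul_comm, smul_smul, inv_mul_cancel₀ hpi, one_smul, ← mul_assoc, hVM, one_mul,
    mul_add, mul_sub, hVC] at hJ'
  simp only [adOp_apply]
  rw [← hJ']
  simp only [smul_mul_assoc, mul_smul_comm, mul_assoc]
  module

/-- Obtained by differentiating Schröder's equation at `t = 0`; thus the obstruction applies to any
Koenigs function, not only the constructed one. -/
theorem IsKoenigsFunction.deriv_mul_generator (hF : IsHolSemigroup F)
    (hf : IsSemigroupGenerator F f) (hh : IsKoenigsFunction F z₀ lam h) {z : ℂ}
    (hz : z ∈ unitDisk) : deriv h z * f z = -lam * h z := by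
  have hd := hh.holomorphic.hasDerivAt (isOpen_unitDisk.mem_nhds hz)
  rw [← hF.zero z hz] at hd
  have h1 : HasDerivWithinAt (fun t : ℝ => h (F t z)) (deriv h (F 0 z) * f z) (Ici 0) 0 :=
    hd.comp_hasDerivWithinAt (0 : ℝ) (hF.hasDerivWithinAt_zero hf hz)
  have h2 : HasDerivWithinAt (fun t : ℝ => Complex.exp (-lam * t) * h z)
      (Complex.exp (-lam * (0 : ℝ)) * (-lam * 1) * h z) (Ici 0) 0 :=
    ((((hasDerivAt_id (0 : ℝ)).ofReal_comp.const_mul (-lam)).cexp).mul_const _).hasDerivWithinAt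
  have h3 := h2.congr_of_mem (fun t ht => hh.schroeder t ht z hz) self_mem_Ici
  have := (uniqueDiffWithinAt_Ici (0 : ℝ)).eq_deriv _ h1 h3
  simpa [hF.zero z hz] using this

theorem hasDerivAt_exp_ofReal_smul (C : 𝒜) (t : ℝ) :
    HasDerivAt (fun t : ℝ => NormedSpace.exp ((t : ℂ) • C))
      (NormedSpace.exp ((t : ℂ) • C) * C) t := by
  have := (hasDerivAt_exp_smul_const C (t : ℂ)).scomp t (hasDerivAt_id t).ofReal_comp
  exact this.congr_deriv (by simp)

theorem not_isLinearizable_of_notMem_range (hF : IsHolSemigroup F)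
    (hf : IsSemigroupGenerator F f) (hz₀ : z₀ ∈ unitDisk) (hh : IsKoenigsFunction F z₀ lam h)
    {B₀ A : 𝒜} {k : ℕ} (hk : 1 ≤ k)
    (hA : A ∉ range (fun a : 𝒜 => ((k : ℂ) * lam) • a - adOp B₀ a)) {Γ : ℝ → ℂ → 𝒜}
    (hΓ : SemicocycleGeneratedBy F Γ fun z => B₀ + h z ^ k • A) : ¬ IsLinearizable F Γ := by
  rintro ⟨M, C, hM, hunit, heq⟩
  refine hA (mem_range_of_intertwining hz₀ hh.holomorphic hh.injOn hh.map_fixed hh.deriv_fixed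
    (fun z hz => hh.deriv_mul_generator hF hf hz) hk hM (hunit z₀ hz₀) (C := C) fun z hz => ?_)
  have hd := hM.hasDerivAt (isOpen_unitDisk.mem_nhds hz)
  rw [← hF.zero z hz] at hd
  have h1 : HasDerivWithinAt (fun t : ℝ => M (F t z)) (f z • deriv M (F 0 z)) (Ici 0) 0 :=
    hd.scomp_hasDerivWithinAt (0 : ℝ) (hF.hasDerivWithinAt_zero hf hz)
  have h2 := h1.mul ((hΓ z hz).2 0 le_rfl)
  have h3 : HasDerivWithinAt (fun t : ℝ => NormedSpace.exp ((t : ℂ) • C) * M z)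
      (NormedSpace.exp (((0 : ℝ) : ℂ) • C) * C * M z) (Ici 0) 0 :=
    ((hasDerivAt_exp_ofReal_smul C 0).mul_const _).hasDerivWithinAt
  have h4 : HasDerivWithinAt (fun t => M (F t z) * Γ t z)
      (NormedSpace.exp (((0 : ℝ) : ℂ) • C) * C * M z) (Ici 0) 0 := h3.congr_of_mem (fun t ht => by
    rw [heq t ht z hz, ← mul_assoc, ← mul_assoc,
      Ring.mul_inverse_cancel _ (hunit _ (hF.mapsTo t ht hz)), one_mul]) self_mem_Ici
  have := (uniqueDiffWithinAt_Ici (0 : ℝ)).eq_deriv _ h2 h4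
  simpa [hF.zero z hz, (hΓ z hz).1] using this

end Nonlinearizable

theorem exists_bound_abs_le {E : Type*} [SeminormedAddCommGroup E] {a : ℝ → E} (ha : Continuous a) (T : ℝ) :
    ∃ K, 0 ≤ K ∧ ∀ t, |t| ≤ T → ‖a t‖ ≤ K := by
  obtain ⟨K, hK⟩ := (isCompact_Icc (a := -T) (b := T)).exists_bound_of_continuousOn ha.continuousOn
  exact ⟨max K 0, le_max_right _ _, fun t ht => (hK t (abs_le.1 ht)).trans (le_max_left _ _)⟩

/-! ### Dyson series for `U' = w a U` -/

section Dyson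

variable {𝒜 : Type u} [NormedRing 𝒜] [NormedAlgebra ℂ 𝒜] {a : ℝ → 𝒜}

/-- The iterated integrals solving `D (n + 1)' = a * D n`, `D 0 = 1`. -/
noncomputable def dysonTerm (a : ℝ → 𝒜) : ℕ → ℝ → 𝒜
  | 0, _ => 1
  | n + 1, t => ∫ s in (0 : ℝ)..t, a s * dysonTerm a n s

/-- The derivatives of the functions `dysonTerm a n`. -/
noncomputable def dysonDeriv (a : ℝ → 𝒜) : ℕ → ℝ → 𝒜
  | 0, _ => 0
  | n + 1, t => a t * dysonTerm a n t

/-- The Dyson series, an entire function of `w` solving `U' = w a U`, `U 0 = 1`. -/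
noncomputable def dysonSeries (a : ℝ → 𝒜) (t : ℝ) (w : ℂ) : 𝒜 := ∑' n, w ^ n • dysonTerm a n t

theorem dysonTerm_zero_right (a : ℝ → 𝒜) (n : ℕ) : dysonTerm a (n + 1) 0 = 0 := by
  simp [dysonTerm]

theorem dysonSeries_zero (a : ℝ → 𝒜) (w : ℂ) : dysonSeries a 0 w = 1 := by
  rw [dysonSeries, tsum_eq_single 0]
  · simp [dysonTerm]
  · intro n hn
    obtain ⟨m, rfl⟩ := Nat.exists_eq_succ_of_ne_zero hn
    rw [Nat.succ_eq_add_one, dysonTerm_zero_right, smul_zero]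

theorem pow_succ_smul_dysonDeriv (a : ℝ → 𝒜) (w : ℂ) (n : ℕ) (s : ℝ) :
    w ^ (n + 1) • dysonDeriv a (n + 1) s = w • (a s * (w ^ n • dysonTerm a n s)) := by
  rw [dysonDeriv, mul_smul_comm, smul_smul, pow_succ']

theorem continuous_dysonTerm (ha : Continuous a) (n : ℕ) : Continuous (dysonTerm a n) := by
  induction n with
  | zero => exact continuous_const
  | succ n ih =>
    exact intervalIntegral.continuous_primitive (μ := MeasureTheory.volume)
      (fun _ _ => (ha.mul ih).intervalIntegrable _ _) 0

/-- Each integration of `|s|^n` contributes a factor `1/(n+1)`, whence the factorial and convergence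
for every `w`. Unordered intervals cover negative `t`. -/
theorem norm_dysonTerm_le (ha : Continuous a) {T K : ℝ} (hK0 : 0 ≤ K)
    (hK : ∀ t, |t| ≤ T → ‖a t‖ ≤ K) (n : ℕ) {t : ℝ} (ht : |t| ≤ T) :
    ‖dysonTerm a n t‖ ≤ ‖(1 : 𝒜)‖ * ((K * |t|) ^ n / n.factorial) := by
  induction n generalizing t with
  | zero => simp [dysonTerm]
  | succ n ih =>
    have hc := ha.mul (continuous_dysonTerm ha n)
    have hpow : Continuous fun s : ℝ => K * (‖(1 : 𝒜)‖ * (K ^ n / n.factorial)) * |s - 0| ^ n := by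
      fun_prop
    have habs : ∀ s ∈ uIoc 0 t, |s| ≤ T := fun s hs => by
      have := abs_sub_left_of_mem_uIcc (uIoc_subset_uIcc hs)
      simp only [sub_zero] at this
      exact this.trans ht
    calc ‖dysonTerm a (n + 1) t‖
        ≤ ∫ s in uIoc 0 t, ‖a s * dysonTerm a n s‖ :=
          intervalIntegral.norm_integral_le_integral_norm_uIoc
      _ ≤ ∫ s in uIoc 0 t, K * (‖(1 : 𝒜)‖ * (K ^ n / n.factorial)) * |s - 0| ^ n := by
          refine MeasureTheory.setIntegral_mono_on (hc.norm.integrableOn_uIoc)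
            hpow.integrableOn_uIoc measurableSet_uIoc fun s hs => ?_
          refine (norm_mul_le _ _).trans ?_
          refine (mul_le_mul (hK s (habs s hs)) (ih (habs s hs)) (norm_nonneg _) hK0).trans_eq ?_
          rw [mul_pow, sub_zero]
          ring
      _ = ‖(1 : 𝒜)‖ * ((K * |t|) ^ (n + 1) / (n + 1).factorial) := by
          rw [MeasureTheory.integral_const_mul, integral_pow_abs_sub_uIoc, sub_zero,
            Nat.factorial_succ]
          push_cast
          field_simp
          ring

theorem norm_pow_smul_dysonTerm_le (ha : Continuous a) {T K R : ℝ} (hK0 : 0 ≤ K)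
    (hK : ∀ t, |t| ≤ T → ‖a t‖ ≤ K) (n : ℕ) {t : ℝ} (ht : |t| ≤ T) {w : ℂ} (hw : ‖w‖ ≤ R) :
    ‖w ^ n • dysonTerm a n t‖ ≤ ‖(1 : 𝒜)‖ * ((R * K * T) ^ n / n.factorial) := by
  have hR : 0 ≤ R := (norm_nonneg w).trans hw
  rw [norm_smul, norm_pow]
  calc ‖w‖ ^ n * ‖dysonTerm a n t‖
      ≤ R ^ n * (‖(1 : 𝒜)‖ * ((K * |t|) ^ n / n.factorial)) := by
        gcongr
        exact norm_dysonTerm_le ha hK0 hK n ht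
    _ ≤ R ^ n * (‖(1 : 𝒜)‖ * ((K * T) ^ n / n.factorial)) := by gcongr
    _ = ‖(1 : 𝒜)‖ * ((R * K * T) ^ n / n.factorial) := by
        rw [mul_assoc R, mul_pow R]
        ring

theorem summable_dysonBound (c x : ℝ) : Summable fun n : ℕ => c * (x ^ n / n.factorial) :=
  (Real.summable_pow_div_factorial x).mul_left c

variable [CompleteSpace 𝒜]

theorem hasDerivAt_dysonTerm (ha : Continuous a) (n : ℕ) (t : ℝ) :
    HasDerivAt (dysonTerm a n) (dysonDeriv a n t) t := by
  cases n with
  | zero => exact hasDerivAt_const t 1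
  | succ n =>
    have hc := ha.mul (continuous_dysonTerm ha n)
    exact intervalIntegral.integral_hasDerivAt_right (hc.intervalIntegrable _ _)
      hc.aestronglyMeasurable.stronglyMeasurableAtFilter hc.continuousAt

theorem continuous_dysonSeries (ha : Continuous a) :
    Continuous fun p : ℝ × ℂ => dysonSeries a p.1 p.2 := by
  rw [continuous_iff_continuousAt]
  rintro ⟨t, w⟩
  obtain ⟨K, hK0, hK⟩ := exists_bound_abs_le ha (|t| + 1)
  have hc : ContinuousOn (fun p : ℝ × ℂ => dysonSeries a p.1 p.2)
      {p | |p.1| < |t| + 1 ∧ ‖p.2‖ < ‖w‖ + 1} := by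
    refine continuousOn_tsum (fun n => ?_)
      (summable_dysonBound ‖(1 : 𝒜)‖ ((‖w‖ + 1) * K * (|t| + 1)))
      fun n p hp => norm_pow_smul_dysonTerm_le ha hK0 hK n hp.1.le hp.2.le
    have := continuous_dysonTerm ha n
    fun_prop
  refine hc.continuousAt (IsOpen.mem_nhds ?_ ⟨by simp, by simp⟩)
  exact (isOpen_lt continuous_fst.abs continuous_const).inter
    (isOpen_lt continuous_snd.norm continuous_const)

theorem differentiable_dysonSeries (ha : Continuous a) (t : ℝ) :
    Differentiable ℂ (dysonSeries a t) := by
  intro w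
  obtain ⟨K, hK0, hK⟩ := exists_bound_abs_le ha |t|
  have hd : DifferentiableOn ℂ (dysonSeries a t) (Metric.ball 0 (‖w‖ + 1)) := by
    refine Complex.differentiableOn_tsum_of_summable_norm
      (summable_dysonBound ‖(1 : 𝒜)‖ ((‖w‖ + 1) * K * |t|)) (fun n => ?_) Metric.isOpen_ball
      fun n v hv => norm_pow_smul_dysonTerm_le ha hK0 hK n le_rfl (mem_ball_zero_iff.1 hv).le
    fun_prop
  exact hd.differentiableAt (Metric.isOpen_ball.mem_nhds (by simp))

theorem summable_dysonSeries (ha : Continuous a) (w : ℂ) (t : ℝ) :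
    Summable fun n => w ^ n • dysonTerm a n t := by
  obtain ⟨K, hK0, hK⟩ := exists_bound_abs_le ha |t|
  exact (summable_dysonBound ‖(1 : 𝒜)‖ (‖w‖ * K * |t|)).of_norm_bounded
    fun n => norm_pow_smul_dysonTerm_le ha hK0 hK n le_rfl le_rfl

theorem tsum_pow_smul_dysonDeriv (ha : Continuous a) (w : ℂ) (t : ℝ) :
    ∑' n, w ^ n • dysonDeriv a n t = w • (a t * dysonSeries a t w) := by
  have hS : HasSum (fun n => w • (a t * (w ^ n • dysonTerm a n t)))
      (w • (a t * dysonSeries a t w)) :=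
    ((summable_dysonSeries ha w t).hasSum.mul_left (a t)).const_smul w
  have hsucc : HasSum (fun n => w ^ (n + 1) • dysonDeriv a (n + 1) t)
      (w • (a t * dysonSeries a t w)) := by
    simpa only [pow_succ_smul_dysonDeriv] using hS
  have := (HasSum.zero_add (f := fun n => w ^ n • dysonDeriv a n t) hsucc).tsum_eq
  simpa [dysonDeriv] using this

theorem hasDerivAt_dysonSeries (ha : Continuous a) (w : ℂ) (t : ℝ) :
    HasDerivAt (fun t => dysonSeries a t w) (w • (a t * dysonSeries a t w)) t := by
  obtain ⟨T, hT⟩ : ∃ T, |t| < T := exists_gt _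
  obtain ⟨K, hK0, hK⟩ := exists_bound_abs_le ha T
  -- Majorant for the differentiated series: the zeroth term is constant, and each later derivative
  -- is bounded through the preceding term.
  obtain ⟨u, hu0, hu1⟩ : ∃ u : ℕ → ℝ, u 0 = 0 ∧ ∀ m, u (m + 1) =
      ‖w‖ * (K * (‖(1 : 𝒜)‖ * ((‖w‖ * K * T) ^ m / m.factorial))) :=
    ⟨fun n => n.casesOn 0 fun m => ‖w‖ * (K * (‖(1 : 𝒜)‖ * ((‖w‖ * K * T) ^ m / m.factorial))),
      rfl, fun _ => rfl⟩
  have hu : Summable u := by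
    rw [← summable_nat_add_iff 1]
    simp only [hu1]
    exact ((summable_dysonBound ‖(1 : 𝒜)‖ (‖w‖ * K * T)).mul_left K).mul_left ‖w‖
  have hbound : ∀ n, ∀ s ∈ Ioo (-T) T, ‖w ^ n • dysonDeriv a n s‖ ≤ u n := by
    intro n s hs
    cases n with
    | zero => simp [hu0, dysonDeriv]
    | succ n =>
      have hs' : |s| ≤ T := (abs_lt.2 hs).le
      rw [pow_succ_smul_dysonDeriv, norm_smul, hu1]
      refine mul_le_mul_of_nonneg_left ((norm_mul_le _ _).trans ?_) (norm_nonneg _)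
      exact mul_le_mul (hK s hs') (norm_pow_smul_dysonTerm_le ha hK0 hK n hs' le_rfl)
        (norm_nonneg _) hK0
  have hder : ∀ n, ∀ s ∈ Ioo (-T) T,
      HasDerivAt (fun s => w ^ n • dysonTerm a n s) (w ^ n • dysonDeriv a n s) s :=
    fun n s _ => (hasDerivAt_dysonTerm ha n s).fun_const_smul (w ^ n)
  have ht := abs_lt.1 hT
  have hmain : HasDerivAt (fun s => ∑' n, w ^ n • dysonTerm a n s)
      (∑' n, w ^ n • dysonDeriv a n t) t :=
    hasDerivAt_tsum_of_isPreconnected hu isOpen_Ioo isPreconnected_Ioo hder hbound ht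
      (summable_dysonSeries ha w t) ht
  rw [tsum_pow_smul_dysonDeriv ha] at hmain
  exact hmain

end Dyson

/-! ### Construction of the semicocycle -/

section Existence

variable {𝒜 : Type u} [NormedRing 𝒜] [NormedAlgebra ℂ 𝒜]

theorem exp_ofReal_smul_comm (C : 𝒜) (t : ℝ) :
    NormedSpace.exp ((t : ℂ) • C) * C = C * NormedSpace.exp ((t : ℂ) • C) :=
  (((Commute.refl C).smul_left (t : ℂ)).exp_left).eq

theorem linear_ode_unique {b Y Z : ℝ → 𝒜} (hb : Continuous b)
    (hY : ∀ t, HasDerivAt Y (b t * Y t) t) (hZ : ∀ t, HasDerivAt Z (b t * Z t) t)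
    (h0 : Y 0 = Z 0) {t : ℝ} (ht : 0 ≤ t) : Y t = Z t := by
  obtain ⟨K, hK0, hK⟩ := exists_bound_abs_le hb t
  refine ODE_solution_unique_of_mem_Icc_right (v := fun t y => b t * y) (K := ⟨K, hK0⟩) (a := 0)
    (b := t) (s := fun _ => univ) (fun s hs => ?_)
    (fun s _ => (hY s).continuousAt.continuousWithinAt) (fun s _ => (hY s).hasDerivWithinAt)
    (fun _ _ => mem_univ _) (fun s _ => (hZ s).continuousAt.continuousWithinAt)
    (fun s _ => (hZ s).hasDerivWithinAt) (fun _ _ => mem_univ _) h0 ⟨ht, le_rfl⟩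
  refine LipschitzOnWith.of_dist_le_mul fun x _ y _ => ?_
  rw [dist_eq_norm, dist_eq_norm, ← mul_sub]
  refine (norm_mul_le _ _).trans (mul_le_mul_of_nonneg_right (hK s ?_) (norm_nonneg _))
  rw [abs_of_nonneg hs.1]
  exact hs.2.le

variable [CompleteSpace 𝒜]

theorem continuous_exp_ofReal_smul (C : 𝒜) :
    Continuous fun t : ℝ => NormedSpace.exp ((t : ℂ) • C) :=
  continuous_iff_continuousAt.2 fun t => (hasDerivAt_exp_ofReal_smul C t).continuousAt

theorem exp_ofReal_smul_mul_exp_neg (C : 𝒜) (t : ℝ) :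
    NormedSpace.exp ((t : ℂ) • C) * NormedSpace.exp (((-t : ℝ) : ℂ) • C) = 1 := by
  let _ := NormedAlgebra.restrictScalars ℚ ℂ 𝒜
  rw [← NormedSpace.exp_add_of_commute (((Commute.refl C).smul_left _).smul_right _), ← add_smul]
  simp

/-- The evolution of `Y' = (B₀ + exp (-μ t) w A) Y`: it is entire in `w` and a cocycle over the
flow `w ↦ exp (-μ t) w`. -/
theorem exists_scalar_cocycle (B₀ A : 𝒜) (μ : ℂ) : ∃ E : ℝ → ℂ → 𝒜,
    (Continuous fun p : ℝ × ℂ => E p.1 p.2) ∧ (∀ t, Differentiable ℂ (E t)) ∧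
    (∀ w, E 0 w = 1) ∧
    (∀ (w : ℂ) (t : ℝ), HasDerivAt (fun t => E t w) ((B₀ + (Complex.exp (-μ * t) * w) • A) * E t w) t) ∧
    ∀ t s : ℝ, 0 ≤ t → ∀ w, E t (Complex.exp (-μ * s) * w) * E s w = E (t + s) w := by
  set e : ℝ → 𝒜 := fun t => NormedSpace.exp ((t : ℂ) • B₀) with he
  have hec : Continuous e := continuous_exp_ofReal_smul B₀
  -- Variation of constants: `Y = e U` solves the required equation once `U' = w a U` with this
  -- conjugated coefficient.
  set a : ℝ → 𝒜 := fun t => Complex.exp (-μ * t) • (e (-t) * A * e t) with ha_def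
  have ha : Continuous a := by fun_prop
  have hder : ∀ (w : ℂ) (t : ℝ), HasDerivAt (fun t => e t * dysonSeries a t w)
      ((B₀ + (Complex.exp (-μ * t) * w) • A) * (e t * dysonSeries a t w)) t := by
    intro w t
    refine ((hasDerivAt_exp_ofReal_smul B₀ t).mul (hasDerivAt_dysonSeries ha w t)).congr_deriv ?_
    have hinv : e t * e (-t) = 1 := exp_ofReal_smul_mul_exp_neg B₀ t
    have h1 : e t * (e (-t) * A * e t * dysonSeries a t w) = A * e t * dysonSeries a t w := by
      simp only [← mul_assoc]
      rw [hinv, one_mul]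
    rw [exp_ofReal_smul_comm]
    change B₀ * e t * dysonSeries a t w + e t * (w • (a t * dysonSeries a t w)) = _
    rw [show a t = Complex.exp (-μ * t) • (e (-t) * A * e t) from rfl]
    simp only [smul_mul_assoc, mul_smul_comm, add_mul, smul_smul, h1]
    simp only [mul_assoc, mul_comm w]
  refine ⟨fun t w => e t * dysonSeries a t w, ?_, ?_, ?_, hder, ?_⟩
  · exact (hec.comp continuous_fst).mul (continuous_dysonSeries ha)
  · exact fun t => (differentiable_dysonSeries ha t).const_mul _
  · intro w
    simp [he, dysonSeries_zero]
  · intro t s ht w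
    -- As functions of `t`, both sides solve the same linear equation, because `exp(-μt) exp(-μs) =
    -- exp(-μ(t+s))`, and they agree at `t = 0`.
    refine linear_ode_unique (b := fun t => B₀ + (Complex.exp (-μ * t) *
        (Complex.exp (-μ * s) * w)) • A)
      (Y := fun t => e t * dysonSeries a t (Complex.exp (-μ * s) * w) * (e s * dysonSeries a s w))
      (Z := fun t => e (t + s) * dysonSeries a (t + s) w) (by fun_prop) (fun r => ?_)
      (fun r => ?_) ?_ ht
    · refine ((hder _ r).mul_const _).congr_deriv ?_
      rw [mul_assoc]
    · refine ((hder w (r + s)).comp_add_const r s).congr_deriv ?_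
      rw [← mul_assoc (Complex.exp _), ← Complex.exp_add, ← mul_add]
      push_cast
      rfl
    · simp [he, dysonSeries_zero]

variable {F : ℝ → ℂ → ℂ} {f h : ℂ → ℂ} {z₀ lam : ℂ}

/-- Substitute `w = h(z)^k` and `μ = kλ`: the `k`-th power of Schröder's equation matches the flow
of `w`. -/
theorem IsKoenigsFunction.exists_semicocycle (hh : IsKoenigsFunction F z₀ lam h) (B₀ A : 𝒜)
    (k : ℕ) : ∃ Γ : ℝ → ℂ → 𝒜, IsSemicocycle F Γ ∧
      SemicocycleGeneratedBy F Γ fun z => B₀ + h z ^ k • A := by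
  obtain ⟨E, hc, hd, h0, hder, hchain⟩ := exists_scalar_cocycle B₀ A (k * lam)
  have hpow : ∀ t : ℝ, 0 ≤ t → ∀ z ∈ unitDisk,
      h (F t z) ^ k = Complex.exp (-(k * lam) * t) * h z ^ k := by
    intro t ht z hz
    rw [hh.schroeder t ht z hz, mul_pow, ← Complex.exp_nat_mul]
    congr 2
    ring
  refine ⟨fun t z => E t (h z ^ k), ⟨fun t _ => ?_, ?_, ?_, fun z _ => h0 _⟩, fun z hz =>
    ⟨h0 _, fun t ht => ?_⟩⟩
  · exact (hd t).comp_differentiableOn (hh.holomorphic.pow k)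
  · refine hc.comp_continuousOn (f := fun p : ℝ × ℂ => (p.1, h p.2 ^ k)) ?_
    refine continuousOn_fst.prodMk (ContinuousOn.pow ?_ k)
    exact hh.holomorphic.continuousOn.comp continuousOn_snd fun p hp => hp.2
  · intro t s ht hs z hz
    rw [hpow s hs z hz, hchain t s ht]
  · beta_reduce
    rw [hpow t ht z hz]
    exact (hder (h z ^ k) t).hasDerivWithinAt

theorem generatesNonlinearizable_of_notMem_range (hF : IsHolSemigroup F)
    (hf : IsSemigroupGenerator F f) (hz₀ : z₀ ∈ unitDisk) (hh : IsKoenigsFunction F z₀ lam h)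
    {B₀ A : 𝒜} {k : ℕ} (hk : 1 ≤ k)
    (hA : A ∉ range (fun a : 𝒜 => ((k : ℂ) * lam) • a - adOp B₀ a)) :
    B₀ + h z₀ ^ k • A = B₀ ∧ GeneratesNonlinearizable F (fun z => B₀ + h z ^ k • A) := by
  refine ⟨by simp [hh.map_fixed, zero_pow (by omega : k ≠ 0)], ?_, hh.exists_semicocycle B₀ A k,
    fun Γ _ hΓ => not_isLinearizable_of_notMem_range hF hf hz₀ hh hk hA hΓ⟩
  exact (differentiableOn_const B₀).add ((hh.holomorphic.pow k).smul_const A)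

end Existence

/-! ### Spectral conditions that provide a direction outside the range -/

section Spectrum

/-- In finite dimension a surjective endomorphism is bijective, so a full range would put `c` in the
resolvent set. -/
theorem exists_notMem_range_of_mem_spectrum {E : Type*} [NormedAddCommGroup E] [NormedSpace ℂ E]
    [FiniteDimensional ℂ E] {L : E →L[ℂ] E} {c : ℂ} (hc : c ∈ spectrum ℂ L) :
    ∃ A, A ∉ range (fun a => c • a - L a) := by
  by_contra! hsurj
  refine hc ?_
  have hs : Function.Surjective (algebraMap ℂ (E →L[ℂ] E) c - L).toLinearMap := hsurj
  have hi := LinearMap.injective_iff_surjective.2 hs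
  refine ContinuousLinearMap.isUnit_iff_bijective.2 ⟨hi, hs⟩

theorem mem_spectrum_of_apply_eq {E : Type*} [NormedAddCommGroup E] [NormedSpace ℂ E]
    {L : E →L[ℂ] E} {c : ℂ} {x : E} (hx : x ≠ 0) (h : L x = c • x) : c ∈ spectrum ℂ L := by
  intro hu
  obtain ⟨V, hV⟩ := hu
  refine hx ?_
  have h1 : (↑V⁻¹ * ↑V : E →L[ℂ] E) x = x := by rw [Units.inv_mul]; rfl
  rw [← h1, hV, mul_apply_eq_comp]
  have h2 : (algebraMap ℂ (E →L[ℂ] E) c - L) x = c • x - L x := rfl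
  rw [h2, h, sub_self, map_zero]

open Matrix in
/-- Differences of eigenvalues of a matrix are eigenvalues of its commutator operator. -/
theorem exists_commutator_eigenvector {n : Type*} [Fintype n] [DecidableEq n] {B : Matrix n n ℂ}
    {α β : ℂ} (hα : α ∈ spectrum ℂ B) (hβ : β ∈ spectrum ℂ B) :
    ∃ X : Matrix n n ℂ, X ≠ 0 ∧ X * B - B * X = (α - β) • X := by
  have hdet : ∀ {γ}, γ ∈ spectrum ℂ B → (algebraMap ℂ (Matrix n n ℂ) γ - B).det = 0 := by
    intro γ hγ
    by_contra h
    exact hγ ((Matrix.isUnit_iff_isUnit_det _).2 (isUnit_iff_ne_zero.2 h))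
  obtain ⟨u, hu0, hu⟩ := Matrix.exists_vecMul_eq_zero_iff.2 (hdet hα)
  obtain ⟨v, hv0, hv⟩ := Matrix.exists_mulVec_eq_zero_iff.2 (hdet hβ)
  rw [Algebra.algebraMap_eq_smul_one, Matrix.vecMul_sub, sub_eq_zero, Matrix.vecMul_smul,
    Matrix.vecMul_one] at hu
  rw [Algebra.algebraMap_eq_smul_one, Matrix.sub_mulVec, sub_eq_zero, Matrix.smul_mulVec,
    Matrix.one_mulVec] at hv
  -- With `u` a left eigenvector for `α` and `v` a right eigenvector for `β`, `X = v uᵀ` satisfies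
  -- `X B = α X` and `B X = β X`.
  refine ⟨vecMulVec v u, ?_, ?_⟩
  · obtain ⟨i, hi⟩ := Function.ne_iff.1 hv0
    obtain ⟨j, hj⟩ := Function.ne_iff.1 hu0
    intro h
    exact mul_ne_zero hi hj (congrFun (congrFun h i) j)
  · rw [vecMulVec_mul, mul_vecMulVec, ← hu, ← hv]
    simp [sub_smul]

/-- An eigenvector is an algebraic object, so it transfers along `e` whatever the norm on `𝒜`. -/
theorem mem_spectrum_adOp {𝒜 : Type u} [NormedRing 𝒜] [NormedAlgebra ℂ 𝒜] {n : ℕ}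
    (e : 𝒜 ≃ₐ[ℂ] Matrix (Fin n) (Fin n) ℂ) {B₀ : 𝒜} {c : ℂ}
    (hc : c ∈ spectrum ℂ B₀ - spectrum ℂ B₀) : c ∈ spectrum ℂ (adOp B₀) := by
  obtain ⟨α, hα, β, hβ, rfl⟩ := Set.mem_sub.1 hc
  rw [← AlgEquiv.spectrum_eq e] at hα hβ
  obtain ⟨X, hX0, hX⟩ := exists_commutator_eigenvector hα hβ
  refine mem_spectrum_of_apply_eq (x := e.symm X) (by simpa using hX0) ?_
  apply e.injective
  rw [adOp_apply, map_sub, map_mul, map_mul, map_smul, AlgEquiv.apply_symm_apply, hX]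

end Spectrum

/-! ### The explicit two-by-two example -/

section Example

variable {F : ℝ → ℂ → ℂ} {Γ : ℝ → ℂ → Matrix (Fin 2) (Fin 2) ℂ}

theorem isHolSemigroup_exp_neg_mul (hF : ∀ t z, F t z = Complex.exp (-(t : ℂ)) * z) :
    IsHolSemigroup F := by
  obtain rfl : F = fun (t : ℝ) z => Complex.exp (-(t : ℂ)) * z := funext₂ hF
  refine ⟨fun t _ => by fun_prop, fun t ht z hz => ?_, by fun_prop, fun t s _ _ z _ => ?_,
    fun z _ => by simp⟩
  · rw [mem_ball_zero_iff] at hz ⊢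
    rw [norm_mul, Complex.norm_exp]
    have : Real.exp (-(t : ℂ)).re ≤ 1 := by simpa using ht
    exact (mul_le_of_le_one_left (norm_nonneg z) this).trans_lt hz
  · rw [← mul_assoc, ← Complex.exp_add]
    push_cast
    ring_nf

theorem isSemigroupGenerator_exp_neg_mul (hF : ∀ t z, F t z = Complex.exp (-(t : ℂ)) * z) :
    IsSemigroupGenerator F fun z => -z := by
  obtain rfl : F = fun (t : ℝ) z => Complex.exp (-(t : ℂ)) * z := funext₂ hF
  refine ⟨by fun_prop, fun z _ => ?_⟩
  have hd : HasDerivAt (fun t : ℝ => Complex.exp (-(t : ℂ)) * z)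
      (Complex.exp (-((0 : ℝ) : ℂ)) * -1 * z) 0 :=
    (((hasDerivAt_id (0 : ℝ)).ofReal_comp.fun_neg).cexp).mul_const z
  have hs := (hasDerivWithinAt_iff_tendsto_slope' (by simp)).1 (hd.hasDerivWithinAt (s := Ioi 0))
  have : Complex.exp (-((0 : ℝ) : ℂ)) * -1 * z = -z := by simp
  rw [this] at hs
  refine hs.congr fun t => ?_
  simp [slope, div_eq_inv_mul]

theorem isKoenigsFunction_exp_neg_mul (hF : ∀ t z, F t z = Complex.exp (-(t : ℂ)) * z) :
    IsKoenigsFunction F 0 1 fun z => z :=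
  ⟨by fun_prop, injOn_id _, rfl, deriv_id 0, fun t _ z _ => by simp [hF]⟩

/-- Reduces continuity and differentiability of the matrix family to its scalar entries, so the
operator norm is never computed. -/
theorem triangular_eq_sum (a b c : ℂ) : !![a, b; 0, c] =
    a • (!![1, 0; 0, 0] : Matrix (Fin 2) (Fin 2) ℂ) + b • !![0, 1; 0, 0] + c • !![0, 0; 0, 1] := by
  ext i j
  fin_cases i <;> fin_cases j <;> simp

theorem isSemicocycle_triangular (hF : ∀ t z, F t z = Complex.exp (-(t : ℂ)) * z)
    (hΓ : ∀ t z, Γ t z = !![Complex.exp t, z * t * Complex.exp t; 0, Complex.exp (2 * t)]) :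
    IsSemicocycle F Γ := by
  obtain rfl : Γ = _ := funext₂ hΓ
  refine ⟨fun t _ => ?_, ?_, fun t s _ _ z _ => ?_, fun z _ => ?_⟩
  · simp only [triangular_eq_sum (Complex.exp _)]
    fun_prop
  · simp only [triangular_eq_sum (Complex.exp _)]
    fun_prop
  · have e1 : Complex.exp (-(s : ℂ)) * Complex.exp s = 1 := by
      rw [← Complex.exp_add, neg_add_cancel, Complex.exp_zero]
    have e2 : Complex.exp (2 * (s : ℂ)) = Complex.exp s * Complex.exp s := by
      rw [← Complex.exp_add, two_mul]
    ext i j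
    fin_cases i <;> fin_cases j
    · simp [hF, Matrix.mul_apply, Fin.sum_univ_two, Complex.exp_add]
    · simp only [hF, Matrix.mul_apply, Fin.sum_univ_two, Complex.exp_add, e2, Matrix.of_apply,
        Matrix.cons_val', Matrix.cons_val_zero, Matrix.cons_val_one, Fin.zero_eta, Fin.mk_one,
        Complex.ofReal_add, Matrix.cons_val_fin_one]
      linear_combination z * t * Complex.exp t * Complex.exp s * e1
    · simp [hF, Matrix.mul_apply, Fin.sum_univ_two]
    · simp [hF, Matrix.mul_apply, Fin.sum_univ_two, mul_add, Complex.exp_add]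
  · simp [Matrix.one_fin_two]

theorem generatedBy_triangular (hF : ∀ t z, F t z = Complex.exp (-(t : ℂ)) * z)
    (hΓ : ∀ t z, Γ t z = !![Complex.exp t, z * t * Complex.exp t; 0, Complex.exp (2 * t)]) :
    SemicocycleGeneratedBy F Γ (fun z => !![1, z; 0, 2]) := by
  obtain rfl : Γ = _ := funext₂ hΓ
  refine fun z _ => ⟨by simp [Matrix.one_fin_two], fun t _ => ?_⟩
  have d0 : HasDerivAt (fun t : ℝ => (t : ℂ)) 1 t := (hasDerivAt_id t).ofReal_comp
  have d1 := d0.cexp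
  have d2 := (d0.const_mul z).mul d1
  have d3 := (d0.const_mul 2).cexp
  have hd := ((d1.smul_const (!![1, 0; 0, 0] : Matrix (Fin 2) (Fin 2) ℂ)).add
    (d2.smul_const (!![0, 1; 0, 0] : Matrix (Fin 2) (Fin 2) ℂ))).add
    (d3.smul_const (!![0, 0; 0, 1] : Matrix (Fin 2) (Fin 2) ℂ))
  have e1 : Complex.exp (-(t : ℂ)) * Complex.exp t = 1 := by
    rw [← Complex.exp_add, neg_add_cancel, Complex.exp_zero]
  have e2 : Complex.exp (2 * (t : ℂ)) = Complex.exp t * Complex.exp t := by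
    rw [← Complex.exp_add, two_mul]
  simp only [triangular_eq_sum (Complex.exp _)]
  refine (hd.congr_deriv ?_).hasDerivWithinAt
  rw [← triangular_eq_sum, ← triangular_eq_sum]
  ext i j
  fin_cases i <;> fin_cases j
  · simp [Matrix.mul_apply, Fin.sum_univ_two]
  · simp only [hF, Matrix.mul_apply, Fin.sum_univ_two, e2, Matrix.of_apply,
        Matrix.cons_val', Matrix.cons_val_zero, Matrix.cons_val_one, Fin.zero_eta, Fin.mk_one,
        Matrix.cons_val_fin_one]
    linear_combination (-z * Complex.exp t) * e1
  · simp [Matrix.mul_apply, Fin.sum_univ_two]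
  · simp [Matrix.mul_apply, Fin.sum_univ_two, mul_comm]

theorem not_isLinearizable_triangular (hF : ∀ t z, F t z = Complex.exp (-(t : ℂ)) * z)
    (hΓ : SemicocycleGeneratedBy F Γ (fun z => !![1, z; 0, 2])) : ¬ IsLinearizable F Γ := by
  have : CompleteSpace (Matrix (Fin 2) (Fin 2) ℂ) := FiniteDimensional.complete ℂ _
  refine not_isLinearizable_of_notMem_range (isHolSemigroup_exp_neg_mul hF)
    (isSemigroupGenerator_exp_neg_mul hF) (Metric.mem_ball_self one_pos)
    (isKoenigsFunction_exp_neg_mul hF) (B₀ := !![1, 0; 0, 2]) (A := !![0, 1; 0, 0]) (k := 1) le_rfl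
    ?_ ?_
  -- The upper right entry of `a - (a B₀ - B₀ a)` is `a₀₁ - (2 a₀₁ - a₀₁) = 0`, whereas that of `A`
  -- is `1`.
  · rintro ⟨a, ha⟩
    have h := congrFun (congrFun ha 0) 1
    simp only [adOp_apply] at h
    simp [Matrix.mul_apply, Matrix.vecMul, Matrix.vecHead, Fin.sum_univ_two] at h
    exact one_ne_zero (by linear_combination -h)
  · convert hΓ using 2 with z
    ext i j
    fin_cases i <;> fin_cases j <;> simp

end Example

theorem mainTheorem5 :
    (∀ (F : ℝ → ℂ → ℂ) (f : ℂ → ℂ) (z₀ lam : ℂ), IsHolSemigroup F → IsSemigroupGenerator F f →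
      z₀ ∈ unitDisk → f z₀ = 0 → lam = -deriv f z₀ → 0 < lam.re →
      (∃ h : ℂ → ℂ, IsKoenigsFunction F z₀ lam h) ∧
      ∀ h : ℂ → ℂ, IsKoenigsFunction F z₀ lam h →
      ∀ (𝒜 : Type u) [NormedRing 𝒜] [NormedAlgebra ℂ 𝒜] [NormOneClass 𝒜] [CompleteSpace 𝒜]
        (B₀ : 𝒜) (k : ℕ), 1 ≤ k →
        -- every perturbation direction outside the range gives a non-linearizable semicocycle
        (∀ A : 𝒜, A ∉ range (fun a : 𝒜 => ((k : ℂ) * lam) • a - adOp B₀ a) →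
          B₀ + h z₀ ^ k • A = B₀ ∧ GeneratesNonlinearizable F (fun z => B₀ + h z ^ k • A)) ∧
        -- finite-dimensional algebras: the spectral condition on `ad B₀` fails at `k`
        (FiniteDimensional ℂ 𝒜 → (k : ℂ) * lam ∈ spectrum ℂ (adOp B₀) →
          ∃ A : 𝒜, A ∉ range (fun a : 𝒜 => ((k : ℂ) * lam) • a - adOp B₀ a) ∧
            B₀ + h z₀ ^ k • A = B₀ ∧ GeneratesNonlinearizable F (fun z => B₀ + h z ^ k • A)) ∧
        -- full matrix algebras: the spectral condition on `B₀` itself fails at `k`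
        (∀ n : ℕ, Nonempty (𝒜 ≃ₐ[ℂ] Matrix (Fin n) (Fin n) ℂ) →
          (k : ℂ) * lam ∈ spectrum ℂ B₀ - spectrum ℂ B₀ →
          ∃ A : 𝒜, A ∉ range (fun a : 𝒜 => ((k : ℂ) * lam) • a - adOp B₀ a) ∧
            B₀ + h z₀ ^ k • A = B₀ ∧ GeneratesNonlinearizable F (fun z => B₀ + h z ^ k • A))) ∧
    -- the explicit `M₂(ℂ)`-valued example over `z ↦ exp(-t) z`
    (∀ (F : ℝ → ℂ → ℂ) (Γ : ℝ → ℂ → Matrix (Fin 2) (Fin 2) ℂ),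
      (∀ t z, F t z = Complex.exp (-(t : ℂ)) * z) →
      (∀ t z, Γ t z = !![Complex.exp t, z * t * Complex.exp t; 0, Complex.exp (2 * t)]) →
      IsHolSemigroup F ∧ IsSemicocycle F Γ ∧ SemicocycleGeneratedBy F Γ (fun z => !![1, z; 0, 2]) ∧
        ¬ IsLinearizable F Γ) := by
  refine ⟨fun F f z₀ lam hF hf hz₀ hfz₀ hlam hre =>
    ⟨hF.exists_isKoenigsFunction hf hz₀ hfz₀ hlam hre, fun h hh 𝒜 _ _ _ _ B₀ k hk => ?_⟩,
    fun F Γ hF hΓ => ?_⟩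
  · have hmain : ∀ A : 𝒜, A ∉ range (fun a : 𝒜 => ((k : ℂ) * lam) • a - adOp B₀ a) →
        B₀ + h z₀ ^ k • A = B₀ ∧ GeneratesNonlinearizable F (fun z => B₀ + h z ^ k • A) :=
      fun A hA => generatesNonlinearizable_of_notMem_range hF hf hz₀ hh hk hA
    have hfin : FiniteDimensional ℂ 𝒜 → (k : ℂ) * lam ∈ spectrum ℂ (adOp B₀) →
        ∃ A : 𝒜, A ∉ range (fun a : 𝒜 => ((k : ℂ) * lam) • a - adOp B₀ a) ∧
          B₀ + h z₀ ^ k • A = B₀ ∧ GeneratesNonlinearizable F (fun z => B₀ + h z ^ k • A) := by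
      intro _ hspec
      obtain ⟨A, hA⟩ := exists_notMem_range_of_mem_spectrum hspec
      exact ⟨A, hA, hmain A hA⟩
    refine ⟨hmain, hfin, ?_⟩
    rintro n ⟨e⟩ hspec
    exact hfin (LinearEquiv.finiteDimensional e.symm.toLinearEquiv) (mem_spectrum_adOp e hspec)
  · have hgen := generatedBy_triangular hF hΓ
    exact ⟨isHolSemigroup_exp_neg_mul hF, isSemicocycle_triangular hF hΓ, hgen,
      not_isLinearizable_triangular hF hgen⟩
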